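/- Let $d\ge 3$ and let $\langle Q,+,\cdot,\le\rangle$ be an ordered field (axiom AxOField). Write coordinate points as $\bar x=\langle x_1,\dots,x_d\rangle\in Q^d$, where $x_1$ is the time coordinate, and put $\mathsf{time}(\bar x,\bar y)=x_1-y_1$, $\mathsf{space}^2(\bar x,\bar y)=\sum_{i=2}^d(x_i-y_i)^2$, $\bar o=\langle 0,\dots,0\rangle$, $\bar 1_t=\langle 1,0,\dots,0\rangle$. Let $B$ be a set of bodies, some of which are inertial observers and some of which are light signals, and let $W\subseteq B\times B\times Q^d$ be a relation; $W(m,b,\bar x)$ is read "$m$ coordinatizes the body $b$ at $\bar x$". Write $\mathrm{ev}_m(\bar x)=\{b\in B: W(m,b,\bar x)\}$ for the event occurring for $m$ at $\bar x$, and let $\mathsf{w}_{mk}$ be the binary relation on $Q^d$ that relates $\bar x$ to $\bar y$ iff $\mathrm{ev}_m(\bar x)=\mathrm{ev}_k(\bar y)\ne\emptyset$. Assume: - (AxPh) for every inertial observer $m$ there is $c_m>0$ in $Q$ such that for all $\bar x,\bar y\in Q^d$ there is a light signal $p$ with $W(m,p,\bar x)$ and $W(m,p,\bar y)$ if and only if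 $\mathsf{space}^2(\bar x,\bar y)=c_m^2\cdot\mathsf{time}(\bar x,\bar y)^2$; - (AxEv) for all inertial observers $m,k$ and every $\bar x\in Q^d$ there is $\bar y\in Q^d$ with $\mathrm{ev}_m(\bar x)=\mathrm{ev}_k(\bar y)$. (Under these axioms $\mathsf{w}_{mk}$ is the graph of a bijection of $Q^d$ whenever $m$ and $k$ are inertial observers.) Let $m$ and $k$ be inertial observers. For an inertial observer $h$, events $\mathrm{ev}_m(\bar x)$ and $\mathrm{ev}_m(\bar y)$ are called simultaneous for $h$ if $x'_1=y'_1$ for all $\bar x',\bar y'\in Q^d$ with $\mathrm{ev}_m(\bar x)=\mathrm{ev}_h(\bar x')$ and $\mathrm{ev}_m(\bar y)=\mathrm{ev}_h(\bar y')$. They are called separated orthogonally to the plane of motion of $k$ according to $m$ if $x_1=y_1$ and $\sum_{i=1}^d (x_i-y_i)\,u_i=0$, where $\bar u=\mathsf{w}_{km}(\bar 1_t)-\mathsf{w}_{km}(\bar o)$. Then for all $\bar x,\bar y\in Q^d$, the events $\mathrm{ev}_m(\bar x)$ and $\mathrm{ev}_m(\bar y)$ are simultaneous for both $m$ and $k$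 if and only if they are separated orthogonally to the plane of motion of $k$ according to $m$. In particular, if moreover every inertial observer $h$ is stationary relative to itself (AxSelf: $W(h,h,\bar x)$ iff $x_2=\dots=x_d=0$) and the squared speed of $k$ according to $m$ is $0$, that is, there are $\bar x\ne\bar y$ with $W(m,k,\bar x)$, $W(m,k,\bar y)$ and $\mathsf{space}^2(\bar x,\bar y)=0$, then for all $\bar x,\bar y\in Q^d$ the events $\mathrm{ev}_m(\bar x)$ and $\mathrm{ev}_m(\bar y)$ are simultaneous for $m$ if and only if they are simultaneous for $k$. -/

import Mathlib

/-- A model of the two-sorted language of observers, light signals and coordinates over a set `B`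
of bodies and a set `Q` of quantities, in spacetime dimension `d`.  `W m b x` says that `m`
coordinatizes the body `b` at the coordinate point `x`. -/
structure WorldviewModel (B Q : Type*) (d : ℕ) where
  /-- `Ob b`: the body `b` is an observer. -/
  Ob : B → Prop
  /-- `IOb b`: the body `b` is an inertial observer. -/
  IOb : B → Prop
  /-- `Ph b`: the body `b` is a light signal. -/
  Ph : B → Prop
  /-- The worldview relation. -/
  W : B → B → (Fin d → Q) → Prop

namespace WorldviewModel

section coordinates

variable {Q : Type*} [Field Q] {d : ℕ} [NeZero d]

/-- Time difference of two coordinate points; coordinate `0` is the time coordinate. -/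
def time (x y : Fin d → Q) : Q := x 0 - y 0

/-- Squared spatial distance of two coordinate points. -/
def spaceSq (x y : Fin d → Q) : Q := ∑ i ∈ Finset.univ.erase (0 : Fin d), (x i - y i) ^ 2

/-- The time unit vector `⟨1, 0, …, 0⟩`. -/
def timeUnit : Fin d → Q := Pi.single 0 1

/-- Orthogonality in the Euclidean sense: `x₁ y₁ + … + x_d y_d = 0`. -/
def EuclOrthogonal (x y : Fin d → Q) : Prop := ∑ i, x i * y i = 0

end coordinates

variable {B Q : Type*} {d : ℕ} (M : WorldviewModel B Q d)

/-- The event occurring for `m` at `x`: the set of bodies that `m` coordinatizes at `x`. -/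
def ev (m : B) (x : Fin d → Q) : Set B := {b | M.W m b x}

/-- The worldview transformation, as a binary relation: it connects the coordinate points at which
`m` and `k` coordinatize the same nonempty event. -/
def worldview (m k : B) (x y : Fin d → Q) : Prop := M.ev m x = M.ev k y ∧ (M.ev m x).Nonempty

/-- All inertial observers coordinatize the same set of events. -/
def AxEv : Prop :=
  ∀ m k : B, M.IOb m → M.IOb k → ∀ x : Fin d → Q, ∃ y : Fin d → Q, ∀ b, M.W m b x ↔ M.W k b y

/-- Two events are simultaneous for `k` if their time coordinates agree wherever `k`
coordinatizes them. -/
def Simultaneous [NeZero d] (k : B) (e f : Set B) : Prop :=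
  ∀ x' y' : Fin d → Q, e = M.ev k x' → f = M.ev k y' → x' 0 = y' 0

variable [Field Q] [NeZero d]

/-- For every inertial observer, the speed of light is the same positive quantity everywhere and in
every direction, and light signals can be sent out everywhere in every direction. -/
def AxPh [LinearOrder Q] : Prop :=
  ∀ m : B, M.IOb m → ∃ c : Q, 0 < c ∧ ∀ x y : Fin d → Q,
    (∃ p, M.Ph p ∧ M.W m p x ∧ M.W m p y) ↔ spaceSq x y = c ^ 2 * time x y ^ 2

/-- Every inertial observer is stationary relative to himself. -/
def AxSelf : Prop :=
  ∀ m : B, M.IOb m → ∀ x : Fin d → Q, M.W m m x ↔ ∀ i, i ≠ 0 → x i = 0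

/-- `v` is a squared speed of `k` according to `m`. -/
def SpeedSq (m k : B) (v : Q) : Prop :=
  ∃ x y : Fin d → Q, x ≠ y ∧ M.W m k x ∧ M.W m k y ∧ spaceSq x y = v * time x y ^ 2

/-- The events at `x` and `y` are separated orthogonally to the plane of motion of `k` according
to `m`: `x` and `y` have the same time coordinate and `x - y` is orthogonal, in the Euclidean sense,
to `p - q`, where `p` and `q` are the values at the time unit vector and at the origin of the
worldview transformation from `k` to `m`. -/
def SeparatedOrthogonally (m k : B) (x y : Fin d → Q) : Prop :=
  x 0 = y 0 ∧ ∃ p q : Fin d → Q, M.worldview k m timeUnit p ∧ M.worldview k m 0 q ∧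
    EuclOrthogonal (x - y) (p - q)

end WorldviewModel

/-! Light signals make the worldview transformation `f` from `k` to `m` a bijection that preserves
null separation for the two Minkowski forms, an Alexandrov–Zeeman situation. Over an ordered field
`f` need not be affine (a field automorphism may intervene), so only what survives is proved: `f` is
additive up to translation (`PreservesNull.map_add`) and sends the time axis into a line
(`map_timeAxis`).

Let `u` be the displacement between the images of the origin and the time unit. The null vectors
whose temporal and spatial parts are `t` and `±s` have null images, and subtracting their squares
shows that spatial axes go to the Minkowski complement of `u`. Hence simultaneity for `k` is
Minkowski orthogonality to `u` in the coordinates of `m` (`time_eq_zero_iff`). For differences with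
zero time component this is Euclidean orthogonality; for `u` along the time axis it is equality of
times. -/

/-! ### Null-preserving bijections of abstract Lorentzian spaces -/

section Lorentzian

variable {Q V V' : Type*} [Field Q] [AddCommGroup V] [Module Q V]
  [AddCommGroup V'] [Module Q V']

/-- A symmetric bilinear form whose totally isotropic subspaces are at most one-dimensional, and
such that the null vectors not orthogonal to a given nonzero null vector generate the space. -/
structure IsLorentzian (B : LinearMap.BilinForm Q V) : Prop where
  symm : ∀ x y, B x y = B y x
  collinear : ∀ n v, n ≠ 0 → B n n = 0 → B v v = 0 → B n v = 0 → ∃ a : Q, v = a • n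
  exists_null_ne_zero : ∃ n, n ≠ 0 ∧ B n n = 0
  closure_eq_top : ∀ n, n ≠ 0 → B n n = 0 →
    AddSubgroup.closure {v | B v v = 0 ∧ B n v ≠ 0} = ⊤

namespace IsLorentzian

variable {B : LinearMap.BilinForm Q V} {B' : LinearMap.BilinForm Q V'}

theorem apply_sub_self (hB : IsLorentzian B) (u v : V) :
    B (u - v) (u - v) = B u u - 2 * B u v + B v v := by
  simp only [map_sub, LinearMap.sub_apply, hB.symm v u]
  ring

theorem apply_sub_smul_self (hB : IsLorentzian B) {n : V} (hn : B n n = 0) (u : V) (a : Q) :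
    B (u - a • n) (u - a • n) = B u u - 2 * a * B u n := by
  rw [hB.apply_sub_self]
  simp only [map_smul, LinearMap.smul_apply, smul_eq_mul, hn]
  ring

theorem exists_null (hB : IsLorentzian B) {n : V} (hn0 : n ≠ 0) (hn : B n n = 0) :
    ∃ v, B v v = 0 ∧ B n v ≠ 0 := by
  by_contra! h
  have he : {v | B v v = 0 ∧ B n v ≠ 0} = (∅ : Set V) := by
    ext v
    simpa using h v
  have ht := hB.closure_eq_top n hn0 hn
  rw [he, AddSubgroup.closure_empty] at ht
  have hm : n ∈ (⊥ : AddSubgroup V) := ht ▸ AddSubgroup.mem_top n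
  exact hn0 (by simpa using hm)

/-- A bijection that preserves null separation in both directions. -/
def PreservesNull (B : LinearMap.BilinForm Q V) (B' : LinearMap.BilinForm Q V') (f : V ≃ V') :
    Prop :=
  ∀ x y, B (x - y) (x - y) = 0 ↔ B' (f x - f y) (f x - f y) = 0

theorem PreservesNull.symm {f : V ≃ V'} (hf : PreservesNull B B' f) :
    PreservesNull B' B f.symm := fun x y => by
  simpa using (hf (f.symm x) (f.symm y)).symm

theorem PreservesNull.null {f : V ≃ V'} (hf : PreservesNull B B' f) {n : V} (hn : B n n = 0)
    (x : V) : B' (f (x + n) - f x) (f (x + n) - f x) = 0 :=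
  (hf _ _).1 (by simpa using hn)

variable [CharZero Q]

/-- Points with the same light cone are equal. -/
theorem eq_of_cone_eq (hB : IsLorentzian B) {x y : V}
    (h : ∀ z, B (x - z) (x - z) = 0 ↔ B (y - z) (y - z) = 0) : x = y := by
  by_contra hxy
  have hn0 : y - x ≠ 0 := sub_ne_zero.2 (Ne.symm hxy)
  have hn : B (y - x) (y - x) = 0 := (h x).1 (by simp)
  obtain ⟨v, hv, hnv⟩ := hB.exists_null hn0 hn
  have h1 := (h (x + v)).1 (by simp [hv])
  rw [← sub_sub, hB.apply_sub_self, hn, hv] at h1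
  simp at h1
  exact hnv (by simpa using h1)

/-- Null lines are mapped into null lines. -/
theorem PreservesNull.line {f : V ≃ V'} (hB' : IsLorentzian B')
    (hf : PreservesNull B B' f) {n : V} (hn : B n n = 0) (x : V) (a : Q) :
    ∃ b : Q, f (x + a • n) = f x + b • (f (x + n) - f x) := by
  rcases eq_or_ne n 0 with rfl | hn0
  · exact ⟨0, by simp⟩
  have h0 : f (x + n) - f x ≠ 0 := by
    rw [sub_ne_zero]
    exact fun h => hn0 (by simpa using f.injective h)
  have h1 := hf.null hn x
  have h2 : B' (f (x + a • n) - f x) (f (x + a • n) - f x) = 0 := hf.null (by simp [hn]) x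
  have h3 : B' (f (x + a • n) - f (x + n)) (f (x + a • n) - f (x + n)) = 0 := by
    refine (hf _ _).1 ?_
    have : x + a • n - (x + n) = (a - 1) • n := by module
    simp [this, hn]
  have h4 : f (x + a • n) - f (x + n) = (f (x + a • n) - f x) - (f (x + n) - f x) := by abel
  rw [h4, hB'.apply_sub_self, h1, h2] at h3
  obtain ⟨b, hb⟩ := hB'.collinear _ (f (x + a • n) - f x) h0 h1 h2
    (by rw [hB'.symm]; simpa using h3)
  exact ⟨b, by rw [← hb]; abel⟩

/-- Null lines are mapped onto null lines. -/
theorem PreservesNull.exists_line {f : V ≃ V'} (hB : IsLorentzian B)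
    (hf : PreservesNull B B' f) {n : V} (hn : B n n = 0) (x : V) (b : Q) :
    ∃ a : Q, f (x + a • n) = f x + b • (f (x + n) - f x) := by
  obtain ⟨a, ha⟩ := hf.symm.line hB (hf.null hn x) (f x) b
  refine ⟨a, ?_⟩
  rw [← f.apply_symm_apply (f x + b • (f (x + n) - f x)), ha]
  simp

/-- Parallel null lines are mapped to parallel null lines. -/
theorem PreservesNull.parallel {f : V ≃ V'} (hB : IsLorentzian B) (hB' : IsLorentzian B')
    (hf : PreservesNull B B' f) {n : V} (hn : B n n = 0) (x y : V) :
    ∃ b : Q, f (y + n) - f y = b • (f (x + n) - f x) := by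
  rcases eq_or_ne n 0 with rfl | hn0
  · exact ⟨0, by simp⟩
  have h0 : f (x + n) - f x ≠ 0 := by
    rw [sub_ne_zero]
    exact fun h => hn0 (by simpa using f.injective h)
  have h1 := hf.null hn x
  have h2 := hf.null hn y
  by_contra hne
  have h3 : B' (f (x + n) - f x) (f (y + n) - f y) ≠ 0 := fun h =>
    hne (hB'.collinear _ _ h0 h1 h2 h)
  set p := f (x + n) - f x with hp
  set r := f (y + n) - f y with hr
  have key : ∀ a b a' b' : Q, f (x + a' • n) = f x + a • p → f (y + b' • n) = f y + b • r →
      (B (x - y) (x - y) + 2 * (a' - b') * B (x - y) n = 0 ↔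
        B' (f x - f y + a • p) (f x - f y + a • p) - 2 * b * B' (f x - f y + a • p) r = 0) := by
    intro a b a' b' ha hb
    have h := hf (x + a' • n) (y + b' • n)
    have e1 : x + a' • n - (y + b' • n) = x - y - (b' - a') • n := by module
    have e2 : f x + a • p - (f y + b • r) = f x - f y + a • p - b • r := by abel
    rw [ha, hb, e1, e2, hB.apply_sub_smul_self hn, hB'.apply_sub_smul_self h2] at h
    rw [← h]
    constructor <;> intro h <;> linear_combination h
  have hlin : ∀ a, B' (f x - f y + a • p) r = B' (f x - f y) r + a * B' p r := by
    intro a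
    simp
  -- By `key`, a point of one line is null separated from all or none of the other when `B (x - y) n
  -- = 0`, and from exactly one point otherwise. As `B' p r ≠ 0`, `a` can be chosen to give the
  -- opposite behaviour in the image.
  by_cases hβ : B (x - y) n = 0
  · obtain ⟨a, ha⟩ : ∃ a, B' (f x - f y + a • p) r = 1 :=
      ⟨(1 - B' (f x - f y) r) / B' p r, by rw [hlin]; field_simp; ring⟩
    obtain ⟨a', ha'⟩ := hf.exists_line hB hn x a
    set s := B' (f x - f y + a • p) (f x - f y + a • p) with hs
    obtain ⟨b', hb'⟩ := hf.exists_line hB hn y (s / 2)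
    obtain ⟨c', hc'⟩ := hf.exists_line hB hn y (s / 2 + 1)
    have k1 := key a _ a' b' ha' hb'
    have k2 := key a _ a' c' ha' hc'
    rw [ha, hβ] at k1 k2
    rw [← hs] at k1 k2
    have h5 := k2.1 (by linear_combination k1.2 (by ring))
    have h6 : (2 : Q) = 0 := by linear_combination -h5
    exact two_ne_zero h6
  · obtain ⟨a, ha⟩ : ∃ a, B' (f x - f y + a • p) r = 0 :=
      ⟨(-B' (f x - f y) r) / B' p r, by rw [hlin]; field_simp; ring⟩
    obtain ⟨a', ha'⟩ := hf.exists_line hB hn x a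
    set b' := a' + B (x - y) (x - y) / (2 * B (x - y) n) with hb'
    obtain ⟨b, hb⟩ := hf.line hB' hn y b'
    obtain ⟨c, hc⟩ := hf.line hB' hn y (b' + 1)
    have k1 := key a b a' b' ha' hb
    have k2 := key a c a' (b' + 1) ha' hc
    rw [ha] at k1 k2
    have h5 : B (x - y) (x - y) + 2 * (a' - b') * B (x - y) n = 0 := by
      rw [hb']; field_simp; ring
    have h6 := k2.2 (by linear_combination k1.1 h5)
    have h7 : 2 * B (x - y) n = 0 := by linear_combination h5 - h6
    simp_all

/-- Opposite sides have parallel images, so closing up gives a relation between the two null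
directions at `f x`. These are not orthogonal, and pairing with one of them forces the scale factor
to be 1. -/
theorem PreservesNull.parallelogram {f : V ≃ V'} (hB : IsLorentzian B) (hB' : IsLorentzian B')
    (hf : PreservesNull B B' f) {n v : V} (hn : B n n = 0) (hv : B v v = 0) (hnv : B n v ≠ 0)
    (x : V) : f (x + v + n) - f (x + v) = f (x + n) - f x := by
  obtain ⟨b, hb⟩ := hf.parallel hB hB' hn x (x + v)
  obtain ⟨c, hc⟩ := hf.parallel hB hB' hv x (x + n)
  have h1 := hf.null hn x
  have h2 := hf.null hv x
  have h3 : B' (f (x + n) - f x) (f (x + v) - f x) ≠ 0 := by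
    intro h
    have h4 := (hf (x + n) (x + v)).2 (by
      rw [← sub_sub_sub_cancel_right (f (x + n)) (f (x + v)) (f x), hB'.apply_sub_self, h1, h2, h]
      simp)
    rw [add_sub_add_left_eq_sub, hB.apply_sub_self, hn, hv] at h4
    simp at h4
    exact hnv h4
  have h5 : (b - 1) • (f (x + n) - f x) = (c - 1) • (f (x + v) - f x) := by
    rw [add_right_comm] at hc
    rw [sub_smul, sub_smul, ← hb, ← hc]
    simp only [one_smul]
    abel
  have h6 := congrArg (fun w => B' w (f (x + v) - f x)) h5
  simp only [map_smul, LinearMap.smul_apply, smul_eq_mul, h2, mul_zero] at h6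
  have h7 : b = 1 := sub_eq_zero.1 ((mul_eq_zero.1 h6).resolve_right h3)
  rw [hb, h7, one_smul]

/-- A bijection preserving null separation in both directions is additive up to a translation. -/
theorem PreservesNull.map_add {f : V ≃ V'} (hB : IsLorentzian B) (hB' : IsLorentzian B')
    (hf : PreservesNull B B' f) (x v : V) : f (x + v) - f x = f v - f 0 := by
  -- The displacement of a null `n` does not depend on the base point: the base is moved along
  -- generators not orthogonal to `n`. A second induction then decomposes `v` itself.
  have hnull : ∀ n, B n n = 0 → ∀ y x, f (x + y + n) - f (x + y) = f (x + n) - f x := by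
    intro n hn y
    rcases eq_or_ne n 0 with rfl | hn0
    · simp
    have hy : y ∈ AddSubgroup.closure {v | B v v = 0 ∧ B n v ≠ 0} := by
      rw [hB.closure_eq_top n hn0 hn]
      exact AddSubgroup.mem_top y
    induction hy using AddSubgroup.closure_induction with
    | mem v hv => exact fun x => hf.parallelogram hB hB' hn hv.1 hv.2 x
    | zero => simp
    | add u v _ _ hu hv =>
      intro x
      rw [← hu x, ← hv (x + u), add_assoc x u v]
    | neg u _ hu =>
      intro x
      simpa using (hu (x + -u)).symm
  obtain ⟨n, hn0, hn⟩ := hB.exists_null_ne_zero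
  have hv : v ∈ AddSubgroup.closure {v | B v v = 0 ∧ B n v ≠ 0} := by
    rw [hB.closure_eq_top n hn0 hn]
    exact AddSubgroup.mem_top v
  have : ∀ x y, f (x + y + v) - f (x + y) = f (x + v) - f x := by
    induction hv using AddSubgroup.closure_induction with
    | mem v hv => exact fun x y => hnull v hv.1 y x
    | zero => simp
    | add u v _ _ hu hv =>
      intro x y
      have h1 := hu x y
      have h2 := hv (x + u) y
      rw [add_right_comm x u y] at h2
      rw [← add_assoc, ← add_assoc, ← sub_add_sub_cancel _ (f (x + y + u)), h2, h1]
      abel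
    | neg u _ hu =>
      intro x y
      have h1 := hu (x + -u) y
      rw [add_right_comm x (-u) y] at h1
      simp only [neg_add_cancel_right] at h1
      rw [← neg_sub (f (x + y)), h1, neg_sub]
  simpa using this 0 x

/-- The additive part of a bijection preserving null separation maps multiples of `n₁ + n₂` to
multiples of its image, for two null vectors that complete to a quadruple of null vectors. -/
theorem PreservesNull.exists_map_smul {f : V ≃ V'} (hB : IsLorentzian B) (hB' : IsLorentzian B')
    (hf : PreservesNull B B' f) {n₁ n₂ n₃ n₄ : V} (h₁ : B n₁ n₁ = 0) (h₂ : B n₂ n₂ = 0)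
    (h₃ : B n₃ n₃ = 0) (h₄ : B n₄ n₄ = 0) (h₁₂ : B n₁ n₂ ≠ 0) (h₁₃ : B n₁ n₃ ≠ 0)
    (h₂₃ : B n₂ n₃ ≠ 0) (hsum : n₁ + n₂ = n₃ + n₄) (t : Q) :
    ∃ a : Q, f (t • (n₁ + n₂)) - f 0 = a • (f (n₁ + n₂) - f 0) := by
  have hadd : ∀ u v, f (u + v) - f 0 = (f u - f 0) + (f v - f 0) := by
    intro u v
    rw [← hf.map_add hB hB' u v]
    abel
  have hline : ∀ n, B n n = 0 → ∃ a : Q, f (t • n) - f 0 = a • (f n - f 0) := by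
    intro n hn
    obtain ⟨a, ha⟩ := hf.line hB' hn 0 t
    exact ⟨a, by simpa [sub_eq_iff_eq_add'] using ha⟩
  have hne : ∀ u v, B u u = 0 → B v v = 0 → B u v ≠ 0 → B' (f u - f 0) (f v - f 0) ≠ 0 := by
    intro u v hu hv huv h
    have h1 : B' (f u - f 0) (f u - f 0) = 0 := (hf u 0).1 (by simpa using hu)
    have h2 : B' (f v - f 0) (f v - f 0) = 0 := (hf v 0).1 (by simpa using hv)
    have h3 := (hf u v).2 (by
      rw [← sub_sub_sub_cancel_right (f u) (f v) (f 0), hB'.apply_sub_self, h1, h2, h]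
      simp)
    rw [hB.apply_sub_self, hu, hv] at h3
    simp at h3
    exact huv h3
  have k₁₂ := hne _ _ h₁ h₂ h₁₂
  have k₁₃ := hne _ _ h₁ h₃ h₁₃
  have k₂₃ := hne _ _ h₂ h₃ h₂₃
  have q₁ : B' (f n₁ - f 0) (f n₁ - f 0) = 0 := (hf n₁ 0).1 (by simpa using h₁)
  have q₂ : B' (f n₂ - f 0) (f n₂ - f 0) = 0 := (hf n₂ 0).1 (by simpa using h₂)
  have q₃ : B' (f n₃ - f 0) (f n₃ - f 0) = 0 := (hf n₃ 0).1 (by simpa using h₃)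
  obtain ⟨a₁, e₁⟩ := hline n₁ h₁
  obtain ⟨a₂, e₂⟩ := hline n₂ h₂
  obtain ⟨a₃, e₃⟩ := hline n₃ h₃
  obtain ⟨a₄, e₄⟩ := hline n₄ h₄
  have s₁ : (f n₁ - f 0) + (f n₂ - f 0) = (f n₃ - f 0) + (f n₄ - f 0) := by
    rw [← hadd, ← hadd, hsum]
  have s₂ : a₁ • (f n₁ - f 0) + a₂ • (f n₂ - f 0) =
      a₃ • (f n₃ - f 0) + a₄ • (f n₄ - f 0) := by
    rw [← e₁, ← e₂, ← e₃, ← e₄, ← hadd, ← hadd, ← smul_add, ← smul_add, hsum]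
  rw [smul_add, hadd, hadd, e₁, e₂]
  generalize f n₁ - f 0 = m₁ at *
  generalize f n₂ - f 0 = m₂ at *
  generalize f n₃ - f 0 = m₃ at *
  generalize f n₄ - f 0 = m₄ at *
  -- With `m₄` eliminated, squaring kills one of the two left coefficients, since `m₃` is null and
  -- `B' m₁ m₂ ≠ 0`. Pairing with `m₃` then kills the other.
  have s₃ : (a₁ - a₄) • m₁ + (a₂ - a₄) • m₂ = (a₃ - a₄) • m₃ := by
    have : m₄ = m₁ + m₂ - m₃ := by rw [s₁]; abel
    rw [this] at s₂
    rw [← sub_eq_zero, ← sub_eq_zero.2 s₂]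
    module
  have s₄ := congrArg (fun w => B' w w) s₃
  have s₅ := congrArg (fun w => B' w m₃) s₃
  simp only [_root_.map_add, map_smul, LinearMap.add_apply, LinearMap.smul_apply, smul_eq_mul, q₁, q₂, q₃,
    hB'.symm m₂ m₁] at s₄ s₅
  have s₆ : (a₁ - a₄) * (a₂ - a₄) = 0 := by
    have : 2 * B' m₁ m₂ * ((a₁ - a₄) * (a₂ - a₄)) = 0 := by linear_combination s₄
    simpa [k₁₂] using this
  have s₇ : a₁ = a₄ ∧ a₂ = a₄ := by
    rcases mul_eq_zero.1 s₆ with h | h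
    · rw [h] at s₅
      simp [k₂₃] at s₅
      exact ⟨sub_eq_zero.1 h, sub_eq_zero.1 s₅⟩
    · rw [h] at s₅
      simp [k₁₃] at s₅
      exact ⟨sub_eq_zero.1 s₅, sub_eq_zero.1 h⟩
  exact ⟨a₄, by rw [s₇.1, s₇.2, smul_add]⟩

end IsLorentzian

end Lorentzian

/-! ### The Minkowski form is Lorentzian -/

section Minkowski

variable {Q : Type*} [Field Q] {d : ℕ} [NeZero d]

/-- The Minkowski form with speed of light `c`; coordinate `0` is the time coordinate. -/
noncomputable def minkowski (c : Q) : LinearMap.BilinForm Q (Fin d → Q) :=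
  LinearMap.mk₂ Q (fun x y => c ^ 2 * (x 0 * y 0) - ∑ i ∈ Finset.univ.erase (0 : Fin d), x i * y i)
    (fun x x' y => by simp only [Pi.add_apply, add_mul, Finset.sum_add_distrib]; ring)
    (fun a x y => by
      simp only [Pi.smul_apply, smul_eq_mul, mul_sub, Finset.mul_sum, mul_assoc]; ring_nf)
    (fun x y y' => by simp only [Pi.add_apply, mul_add, Finset.sum_add_distrib]; ring)
    (fun a x y => by
      simp only [Pi.smul_apply, smul_eq_mul, mul_sub, Finset.mul_sum, mul_left_comm _ a])

theorem minkowski_apply (c : Q) (x y : Fin d → Q) : minkowski c x y =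
    c ^ 2 * (x 0 * y 0) - ∑ i ∈ Finset.univ.erase (0 : Fin d), x i * y i := rfl

theorem minkowski_sub_self (c : Q) (x y : Fin d → Q) : minkowski c (x - y) (x - y) =
    c ^ 2 * WorldviewModel.time x y ^ 2 - WorldviewModel.spaceSq x y := by
  simp only [minkowski_apply, WorldviewModel.time, WorldviewModel.spaceSq, sq, Pi.sub_apply]

theorem minkowski_single_zero (c : Q) (x : Fin d → Q) (t : Q) :
    minkowski c x (Pi.single 0 t) = c ^ 2 * (x 0 * t) := by
  rw [minkowski_apply, Finset.sum_eq_zero]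
  · simp
  · intro i hi
    simp [(Finset.mem_erase.1 hi).1]

theorem minkowski_single (c : Q) (x : Fin d → Q) {i : Fin d} (hi : i ≠ 0) (s : Q) :
    minkowski c x (Pi.single i s) = -(x i * s) := by
  rw [minkowski_apply, Finset.sum_eq_single i]
  · simp [hi.symm]
  · intro j _ hj
    simp [hj]
  · simp [hi]

/-- The null vector with time component `s` and `i`-th component `s * r`, where `r ^ 2 = c ^ 2`. -/
def nullVec (r : Q) (i : Fin d) (s : Q) : Fin d → Q := Pi.single 0 s + Pi.single i (s * r)

theorem minkowski_nullVec (c : Q) (x : Fin d → Q) (r : Q) {i : Fin d} (hi : i ≠ 0) (s : Q) :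
    minkowski c x (nullVec r i s) = s * (c ^ 2 * x 0 - r * x i) := by
  rw [nullVec, map_add, minkowski_single_zero, minkowski_single c x hi]
  ring

theorem nullVec_apply_zero (r : Q) {i : Fin d} (hi : i ≠ 0) (s : Q) :
    nullVec r i s 0 = s := by
  simp [nullVec, hi.symm]

theorem nullVec_apply_self (r : Q) {i : Fin d} (hi : i ≠ 0) (s : Q) :
    nullVec r i s i = s * r := by
  simp [nullVec, hi]

theorem nullVec_apply_of_ne (r : Q) {i j : Fin d} (hj : j ≠ 0) (hij : j ≠ i) (s : Q) :
    nullVec r i s j = 0 := by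
  simp [nullVec, hj, hij]

theorem nullVec_null {c r : Q} (hr : r ^ 2 = c ^ 2) {i : Fin d} (hi : i ≠ 0) (s : Q) :
    minkowski c (nullVec r i s) (nullVec r i s) = 0 := by
  rw [minkowski_nullVec c _ r hi, nullVec_apply_zero r hi, nullVec_apply_self r hi]
  linear_combination -s ^ 2 * hr

theorem exists_two_spatial (hd : 3 ≤ d) (i : Fin d) : ∃ j : Fin d, j ≠ 0 ∧ j ≠ i := by
  have h : ({0, i} : Finset (Fin d)).card < (Finset.univ : Finset (Fin d)).card := by
    rw [Finset.card_univ, Fintype.card_fin]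
    exact lt_of_le_of_lt Finset.card_le_two hd
  obtain ⟨j, -, hj⟩ := Finset.exists_mem_notMem_of_card_lt_card h
  simp only [Finset.mem_insert, Finset.mem_singleton, not_or] at hj
  exact ⟨j, hj⟩

/-- Both sums are the purely temporal vector with entry `2 * s`, whatever the spatial axis. -/
theorem nullVec_relation (r : Q) (i j : Fin d) (s : Q) :
    nullVec r i s + nullVec (-r) i s = nullVec r j s + nullVec (-r) j s := by
  simp only [nullVec, mul_neg, Pi.single_neg]
  abel

variable [LinearOrder Q] [IsStrictOrderedRing Q]

/-- The vectors `nullVec (±c) i s` generate the whole space. -/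
theorem addSubgroup_eq_top (hd : 3 ≤ d) {c : Q} (hc : 0 < c) (H : AddSubgroup (Fin d → Q))
    (hH : ∀ (i : Fin d) (s : Q), i ≠ 0 → nullVec c i s ∈ H ∧ nullVec (-c) i s ∈ H) : H = ⊤ := by
  have h0 : ∀ t : Q, Pi.single 0 t ∈ H := by
    intro t
    obtain ⟨j, hj, -⟩ := exists_two_spatial hd 0
    have h := H.add_mem (hH j (t / 2) hj).1 (hH j (t / 2) hj).2
    have e : nullVec c j (t / 2) + nullVec (-c) j (t / 2) = Pi.single 0 t := by
      rw [nullVec, nullVec, mul_neg, Pi.single_neg, ← add_halves t, Pi.single_add]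
      simp only [add_halves]
      abel
    rwa [e] at h
  rw [eq_top_iff]
  intro x _
  rw [← Finset.univ_sum_single x]
  refine H.sum_mem fun i _ => ?_
  rcases eq_or_ne i 0 with rfl | hi
  · exact h0 _
  · have h := H.sub_mem (hH i (x i / c) hi).1 (h0 (x i / c))
    rwa [nullVec, add_sub_cancel_left, div_mul_cancel₀ _ hc.ne'] at h

theorem eq_zero_of_null {c : Q} {x : Fin d → Q} (hx : minkowski c x x = 0) (h0 : x 0 = 0) :
    x = 0 := by
  rw [minkowski_apply, h0] at hx
  have hs : ∑ i ∈ Finset.univ.erase (0 : Fin d), x i * x i = 0 := by linear_combination -hx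
  rw [Finset.sum_eq_zero_iff_of_nonneg fun i _ => mul_self_nonneg (x i)] at hs
  ext i
  rcases eq_or_ne i 0 with rfl | hi
  · exact h0
  · exact mul_self_eq_zero.1 (hs i (by simp [hi]))

/-- A null vector with zero time component vanishes, its spatial part being a sum of squares; this
gives collinearity. For generation, a vector `nullVec r i s` orthogonal to `n` is rewritten through
a second spatial axis, which is where `3 ≤ d` matters. -/
theorem minkowski_isLorentzian (hd : 3 ≤ d) {c : Q} (hc : 0 < c) :
    IsLorentzian (minkowski c : LinearMap.BilinForm Q (Fin d → Q)) := by
  have hsymm : ∀ x y : Fin d → Q, minkowski c x y = minkowski c y x := fun x y => by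
    simp only [minkowski_apply, mul_comm]
  have hcol : ∀ n v : Fin d → Q, n ≠ 0 → minkowski c n n = 0 → minkowski c v v = 0 →
      minkowski c n v = 0 → ∃ a : Q, v = a • n := by
    intro n v hn0 hn hv hnv
    have h0 : n 0 ≠ 0 := fun h => hn0 (eq_zero_of_null hn h)
    refine ⟨v 0 / n 0, sub_eq_zero.1 (eq_zero_of_null (c := c) ?_ ?_)⟩
    · simp [hn, hv, hnv, hsymm v n]
    · simp [h0]
  refine ⟨hsymm, hcol, ?_, ?_⟩
  · obtain ⟨i, hi, -⟩ := exists_two_spatial hd 0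
    refine ⟨nullVec c i 1, fun h => ?_, nullVec_null rfl hi 1⟩
    have := nullVec_apply_zero c hi 1
    simp [h] at this
  · intro n hn0 hn
    have key : ∀ r : Q, r ^ 2 = c ^ 2 → ∀ (i : Fin d) (s : Q), i ≠ 0 →
        nullVec r i s ∈ AddSubgroup.closure {v | minkowski c v v = 0 ∧ minkowski c n v ≠ 0} := by
      intro r hr i s hi
      rcases eq_or_ne s 0 with rfl | hs
      · simp [nullVec]
      by_cases hnv : minkowski c n (nullVec r i s) = 0
      · obtain ⟨j, hj, hji⟩ := exists_two_spatial hd i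
        obtain ⟨a, ha⟩ := hcol n _ hn0 hn (nullVec_null hr hi s) hnv
        have hr' : (-r) ^ 2 = c ^ 2 := by rw [neg_sq, hr]
        -- Here `nullVec r i s` is a multiple of `n`, so non-orthogonality may be tested against it
        -- instead of `n`.
        have hmem : ∀ v, minkowski c v v = 0 → minkowski c (nullVec r i s) v ≠ 0 →
            v ∈ AddSubgroup.closure {v | minkowski c v v = 0 ∧ minkowski c n v ≠ 0} := by
          intro v hv h
          refine AddSubgroup.subset_closure ⟨hv, fun h' => h ?_⟩
          rw [ha, map_smul, LinearMap.smul_apply, h', smul_zero]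
        rw [eq_sub_of_add_eq (nullVec_relation r i j s)]
        refine AddSubgroup.sub_mem _ (AddSubgroup.add_mem _ ?_ ?_) ?_
        · refine hmem _ (nullVec_null hr hj s) ?_
          rw [minkowski_nullVec c _ r hj, nullVec_apply_zero r hi, nullVec_apply_of_ne r hj hji]
          simp [hs, hc.ne']
        · refine hmem _ (nullVec_null hr' hj s) ?_
          rw [minkowski_nullVec c _ _ hj, nullVec_apply_zero r hi, nullVec_apply_of_ne r hj hji]
          simp [hs, hc.ne']
        · refine hmem _ (nullVec_null hr' hi s) ?_
          rw [minkowski_nullVec c _ _ hi, nullVec_apply_zero r hi, nullVec_apply_self r hi]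
          have : s * (c ^ 2 * s - -r * (s * r)) = 2 * c ^ 2 * s ^ 2 := by
            linear_combination s ^ 2 * hr
          rw [this]
          positivity
      · exact AddSubgroup.subset_closure ⟨nullVec_null hr hi s, hnv⟩
    exact addSubgroup_eq_top hd hc _ fun i s hi =>
      ⟨key c rfl i s hi, key (-c) (neg_sq c) i s hi⟩

open IsLorentzian

/-! ### Simultaneity under null-preserving bijections -/

section Transformation

variable {c c' : Q} {f : (Fin d → Q) ≃ (Fin d → Q)}

/-- The time axis is mapped into a line. -/
theorem map_timeAxis (hd : 3 ≤ d) (hc : 0 < c) (hc' : 0 < c')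
    (hf : PreservesNull (minkowski c) (minkowski c') f) (t : Q) :
    ∃ a : Q, f (Pi.single 0 t) - f 0 = a • (f (Pi.single 0 1) - f 0) := by
  obtain ⟨i, hi, -⟩ := exists_two_spatial hd 0
  obtain ⟨j, hj, hji⟩ := exists_two_spatial hd i
  have hn : (-c) ^ 2 = c ^ 2 := neg_sq c
  have e : nullVec c i (1 / 2) + nullVec (-c) i (1 / 2) = Pi.single 0 1 := by
    have h : (Pi.single 0 (1 : Q) : Fin d → Q) = Pi.single 0 (1 / 2) + Pi.single 0 (1 / 2) := by
      rw [← Pi.single_add, add_halves]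
    rw [h]
    simp only [nullVec, mul_neg, Pi.single_neg]
    abel
  -- The factor `1 / 2` makes each pair of opposite null vectors add up to the time unit.
  have h := hf.exists_map_smul (minkowski_isLorentzian hd hc) (minkowski_isLorentzian hd hc')
    (n₁ := nullVec c i (1 / 2)) (n₂ := nullVec (-c) i (1 / 2)) (n₃ := nullVec c j (1 / 2))
    (n₄ := nullVec (-c) j (1 / 2)) (nullVec_null rfl hi _) (nullVec_null hn hi _)
    (nullVec_null rfl hj _) (nullVec_null hn hj _)
    (by
      rw [minkowski_nullVec c _ _ hi, nullVec_apply_zero c hi, nullVec_apply_self c hi]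
      have : (1 / 2 : Q) * (c ^ 2 * (1 / 2) - -c * (1 / 2 * c)) = c ^ 2 / 2 := by ring
      rw [this]
      positivity)
    (by
      rw [minkowski_nullVec c _ _ hj, nullVec_apply_zero c hi, nullVec_apply_of_ne c hj hji]
      simp [hc.ne'])
    (by
      rw [minkowski_nullVec c _ _ hj, nullVec_apply_zero _ hi, nullVec_apply_of_ne _ hj hji]
      simp [hc.ne'])
    (nullVec_relation c i j _) t
  rw [e] at h
  simpa [← Pi.single_smul] using h

/-- Points are simultaneous iff the difference of their images is Minkowski orthogonal to the
image of the time unit vector. -/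
theorem time_eq_zero_iff (hd : 3 ≤ d) (hc : 0 < c) (hc' : 0 < c')
    (hf : PreservesNull (minkowski c) (minkowski c') f) (v : Fin d → Q) :
    v 0 = 0 ↔ minkowski c' (f v - f 0) (f (Pi.single 0 1) - f 0) = 0 := by
  have hB := minkowski_isLorentzian hd hc
  have hB' := minkowski_isLorentzian hd hc'
  have hadd : ∀ u v, f (u + v) - f 0 = (f u - f 0) + (f v - f 0) := by
    intro u v
    rw [← hf.map_add hB hB' u v]
    abel
  have hneg : ∀ u, f (-u) - f 0 = -(f u - f 0) := by
    intro u
    have := hadd u (-u)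
    rw [add_neg_cancel, sub_self] at this
    exact (neg_eq_of_add_eq_zero_right this.symm).symm
  set u := f (Pi.single 0 1) - f 0 with hu
  have hinj : ∀ x, f x - f 0 = 0 → x = 0 := fun x hx => f.injective (sub_eq_zero.1 hx)
  have haxis : ∀ (i : Fin d) (s : Q), i ≠ 0 → minkowski c' (f (Pi.single i s) - f 0) u = 0 := by
    intro i s hi
    rcases eq_or_ne s 0 with rfl | hs
    · simp
    set t := s / c with ht
    have hst : s = t * c := (div_mul_cancel₀ _ hc.ne').symm
    have ht0 : t ≠ 0 := div_ne_zero hs hc.ne'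
    have n₁ := (hf (nullVec c i t) 0).1 (by simpa using nullVec_null rfl hi t)
    have n₂ := (hf (nullVec (-c) i t) 0).1 (by simpa using nullVec_null (neg_sq c) hi t)
    rw [nullVec, ← hst, hadd] at n₁
    rw [nullVec, mul_neg, ← hst, Pi.single_neg, hadd, hneg, ← sub_eq_add_neg,
      hB'.apply_sub_self] at n₂
    obtain ⟨a, ha⟩ := map_timeAxis hd hc hc' hf t
    have ha0 : a ≠ 0 := by
      rintro rfl
      rw [zero_smul] at ha
      exact ht0 (by simpa using hinj _ ha)
    rw [← hu] at ha
    rw [ha] at n₁ n₂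
    simp only [_root_.map_add, map_smul, LinearMap.add_apply, LinearMap.smul_apply, smul_eq_mul,
      hB'.symm (f (Pi.single i s) - f 0) u] at n₁ n₂
    have h4 : 4 * a * minkowski c' u (f (Pi.single i s) - f 0) = 0 := by
      linear_combination n₁ - n₂
    rw [hB'.symm]
    simpa [ha0] using h4
  have hsp : ∀ w : Fin d → Q, w 0 = 0 → minkowski c' (f w - f 0) u = 0 := by
    intro w hw
    -- Only additivity is available, which suffices because `haxis` covers every multiple of a
    -- spatial basis vector.
    let g : (Fin d → Q) →+ Q :=
      { toFun := fun w => minkowski c' (f w - f 0) u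
        map_zero' := by simp
        map_add' := fun x y => by rw [hadd, _root_.map_add, LinearMap.add_apply] }
    change g w = 0
    rw [← Finset.univ_sum_single w, map_sum]
    refine Finset.sum_eq_zero fun i _ => ?_
    rcases eq_or_ne i 0 with rfl | hi
    · simp [hw]
    · exact haxis i _ hi
  have huu : minkowski c' u u ≠ 0 := by
    intro h
    have := (hf (Pi.single 0 1) 0).2 h
    rw [sub_zero, minkowski_single_zero] at this
    simp [hc.ne'] at this
  refine ⟨hsp v, fun h => ?_⟩
  have e : v = Pi.single 0 (v 0) + (v - Pi.single 0 (v 0)) := by abel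
  obtain ⟨a, ha⟩ := map_timeAxis hd hc hc' hf (v 0)
  rw [e, hadd, _root_.map_add, LinearMap.add_apply,
    hsp (v - (Pi.single 0 (v 0) : Fin d → Q)) (by simp), ha,
    map_smul, LinearMap.smul_apply, smul_eq_mul, add_zero] at h
  rw [(mul_eq_zero.1 h).resolve_right huu, zero_smul] at ha
  simpa using hinj _ ha

end Transformation

end Minkowski

/-! ### From events to null-preserving bijections -/

namespace WorldviewModel

open IsLorentzian

variable {B Q : Type*} [Field Q] [LinearOrder Q] [IsStrictOrderedRing Q] {d : ℕ} [NeZero d]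
  {M : WorldviewModel B Q d}

omit [LinearOrder Q] [IsStrictOrderedRing Q] in
theorem exists_photon_iff {m : B} {c : Q} (h : ∀ x y : Fin d → Q,
    (∃ p, M.Ph p ∧ M.W m p x ∧ M.W m p y) ↔ spaceSq x y = c ^ 2 * time x y ^ 2)
    (x y : Fin d → Q) :
    minkowski c (x - y) (x - y) = 0 ↔ ∃ p, M.Ph p ∧ p ∈ M.ev m x ∧ p ∈ M.ev m y := by
  rw [minkowski_sub_self, sub_eq_zero, eq_comm]
  exact (h x y).symm

omit [LinearOrder Q] [IsStrictOrderedRing Q] in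
theorem ev_nonempty {m : B} {c : Q} (h : ∀ x y : Fin d → Q,
    (∃ p, M.Ph p ∧ M.W m p x ∧ M.W m p y) ↔ spaceSq x y = c ^ 2 * time x y ^ 2)
    (x : Fin d → Q) : (M.ev m x).Nonempty := by
  obtain ⟨p, -, hp, -⟩ := (exists_photon_iff h x x).1 (by simp)
  exact ⟨p, hp⟩

/-- The event at a point determines its light cone, and the cone determines its vertex. -/
theorem ev_injective (hd : 3 ≤ d) {m : B} {c : Q} (hc : 0 < c)
    (h : ∀ x y : Fin d → Q,
      (∃ p, M.Ph p ∧ M.W m p x ∧ M.W m p y) ↔ spaceSq x y = c ^ 2 * time x y ^ 2) :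
    Function.Injective (M.ev m) := by
  intro x y hxy
  refine (minkowski_isLorentzian hd hc).eq_of_cone_eq fun z => ?_
  rw [exists_photon_iff h, exists_photon_iff h, hxy]

/-- Worldview transformations are bijections preserving null separation. -/
theorem exists_worldview_equiv (hd : 3 ≤ d) (hEv : M.AxEv) {m k : B} (hm : M.IOb m)
    (hk : M.IOb k) {cm ck : Q} (hcm : 0 < cm) (hck : 0 < ck)
    (hPm : ∀ x y : Fin d → Q,
      (∃ p, M.Ph p ∧ M.W m p x ∧ M.W m p y) ↔ spaceSq x y = cm ^ 2 * time x y ^ 2)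
    (hPk : ∀ x y : Fin d → Q,
      (∃ p, M.Ph p ∧ M.W k p x ∧ M.W k p y) ↔ spaceSq x y = ck ^ 2 * time x y ^ 2) :
    ∃ f : (Fin d → Q) ≃ (Fin d → Q), (∀ x, M.ev k x = M.ev m (f x)) ∧
      PreservesNull (minkowski ck) (minkowski cm) f := by
  choose f hf using hEv k m hk hm
  choose g hg using hEv m k hm hk
  have hf' : ∀ x, M.ev k x = M.ev m (f x) := fun x => Set.ext (hf x)
  have hg' : ∀ x, M.ev m x = M.ev k (g x) := fun x => Set.ext (hg x)
  refine ⟨⟨f, g, fun x => ev_injective hd hck hPk ?_, fun x => ev_injective hd hcm hPm ?_⟩,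
    hf', fun x y => ?_⟩
  · rw [← hg', ← hf']
  · rw [← hf', ← hg']
  · change _ ↔ minkowski cm (f x - f y) (f x - f y) = 0
    rw [exists_photon_iff hPk, exists_photon_iff hPm, hf', hf']

end WorldviewModel

/-! ### The simultaneity theorem -/

open WorldviewModel IsLorentzian in
theorem theorem7p14 {B Q : Type*} [Field Q] [LinearOrder Q] [IsStrictOrderedRing Q]
    {d : ℕ} [NeZero d] (hd : 3 ≤ d) (M : WorldviewModel B Q d) (hPh : M.AxPh) (hEv : M.AxEv)
    (m k : B) (hm : M.IOb m) (hk : M.IOb k) :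
    (∀ x y : Fin d → Q,
      (M.Simultaneous m (M.ev m x) (M.ev m y) ∧ M.Simultaneous k (M.ev m x) (M.ev m y)) ↔
        M.SeparatedOrthogonally m k x y) ∧
    (M.AxSelf → M.SpeedSq m k 0 → ∀ x y : Fin d → Q,
      M.Simultaneous m (M.ev m x) (M.ev m y) ↔ M.Simultaneous k (M.ev m x) (M.ev m y)) := by
  obtain ⟨cm, hcm, hPm⟩ := hPh m hm
  obtain ⟨ck, hck, hPk⟩ := hPh k hk
  have hBm := minkowski_isLorentzian hd hcm
  have hBk := minkowski_isLorentzian hd hck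
  have injm := ev_injective hd hcm hPm
  have injk := ev_injective hd hck hPk
  obtain ⟨f, hf, hnull⟩ := exists_worldview_equiv hd hEv hm hk hcm hck hPm hPk
  set u := f timeUnit - f 0 with hu
  have hsub : ∀ x y, f x - f y = f (x - y) - f 0 := fun x y => by
    simpa using hnull.map_add hBk hBm y (x - y)
  have simm : ∀ x y, M.Simultaneous m (M.ev m x) (M.ev m y) ↔ x 0 = y 0 := by
    refine fun x y => ⟨fun h => h x y rfl rfl, fun h x' y' hx hy => ?_⟩
    rw [← injm hx, ← injm hy, h]
  have simk : ∀ x y, M.Simultaneous k (M.ev m x) (M.ev m y) ↔ minkowski cm (x - y) u = 0 := by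
    intro x y
    obtain ⟨a, rfl⟩ := f.surjective x
    obtain ⟨b, rfl⟩ := f.surjective y
    rw [hsub, hu, timeUnit, ← time_eq_zero_iff hd hck hcm hnull, Pi.sub_apply, sub_eq_zero,
      ← hf, ← hf]
    refine ⟨fun h => h a b rfl rfl, fun h x' y' hx hy => ?_⟩
    rw [← injk hx, ← injk hy, h]
  refine ⟨fun x y => ?_, fun hself hspeed x y => ?_⟩
  · have hsep : M.SeparatedOrthogonally m k x y ↔ x 0 = y 0 ∧ EuclOrthogonal (x - y) u := by
      refine and_congr_right fun _ => ⟨?_, fun h => ⟨f timeUnit, f 0, ?_, ?_, h⟩⟩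
      · rintro ⟨p, q, hp, hq, h⟩
        rwa [← injm ((hf _).symm.trans hp.1), ← injm ((hf _).symm.trans hq.1)] at h
      all_goals exact ⟨hf _, ev_nonempty hPk _⟩
    rw [simm, simk, hsep]
    refine and_congr_right fun h => ?_
    have h0 : (x - y) 0 = 0 := by simp [h]
    rw [minkowski_apply, EuclOrthogonal, ← Finset.add_sum_erase _ _ (Finset.mem_univ 0), h0,
      zero_mul, mul_zero, zero_add, zero_sub, neg_eq_zero]
  · obtain ⟨p, q, hpq, hp, hq, hs⟩ := hspeed
    obtain ⟨a, rfl⟩ := f.surjective p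
    obtain ⟨b, rfl⟩ := f.surjective q
    have ha := (hself k hk a).1 ((Set.ext_iff.1 (hf a) k).2 hp)
    have hb := (hself k hk b).1 ((Set.ext_iff.1 (hf b) k).2 hq)
    -- `AxSelf` puts `a` and `b` on the time axis of `k`, so `f a - f b` is a multiple of `u`; zero
    -- speed then makes `u` purely temporal.
    have hab : a - b = Pi.single 0 ((a - b) 0) := by
      ext i
      rcases eq_or_ne i 0 with rfl | hi
      · simp
      · simp [hi, ha i hi, hb i hi]
    obtain ⟨t, ht⟩ := map_timeAxis hd hck hcm hnull ((a - b) 0)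
    rw [← hab, ← hsub] at ht
    change f a - f b = t • u at ht
    have ht0 : t ≠ 0 := by
      rintro rfl
      rw [zero_smul] at ht
      exact hpq (sub_eq_zero.1 ht)
    have hsp : ∀ i, i ≠ 0 → u i = 0 := by
      intro i hi
      rw [spaceSq, zero_mul, Finset.sum_eq_zero_iff_of_nonneg fun i _ => sq_nonneg _] at hs
      have h1 := pow_eq_zero_iff two_ne_zero |>.1 (hs i (by simp [hi]))
      have h2 := congrFun ht i
      rw [Pi.sub_apply, h1, Pi.smul_apply, smul_eq_mul] at h2
      exact (mul_eq_zero.1 h2.symm).resolve_left ht0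
    have hu1 : u = Pi.single 0 (u 0) := by
      ext i
      rcases eq_or_ne i 0 with rfl | hi
      · simp
      · simp [hi, hsp i hi]
    have hu0 : u 0 ≠ 0 := by
      intro h
      rw [h, Pi.single_zero] at hu1
      rw [hu1, smul_zero] at ht
      exact hpq (sub_eq_zero.1 ht)
    rw [simm, simk, hu1, minkowski_single_zero]
    simp [hcm.ne', hu0, sub_eq_zero]
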